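/- Let $G$ be a (discrete) group. Let $r\mathcal G$ be the groupoid whose objects are the elements of $G$ and whose morphisms are $\mathrm{Mor}(a,b)=\{x\in G : ax=b\}$, the composite of $x\colon a\to b$ and $y\colon b\to c$ being $xy$; the group $G$ acts on $r\mathcal G$ by left translations, $h$ sending $a$ to $ha$ and $x\colon a\to b$ to $x\colon ha\to hb$. Regard $G$ also as a category with a single object, with morphisms the elements of $G$ and with composite of $x$ followed by $y$ equal to $yx$. For a category $\mathcal C$ let $B\mathcal C$ be its classifying space, i.e. the geometric realization of its nerve; write $BG$ and $Br\mathcal G$ for the classifying spaces of the one-object category $G$ and of $r\mathcal G$. Then: 1. $BG$ is an Eilenberg–MacLane complex $K(G,1)$: it is a path-connected CW complex, $\pi_1(BG,p)\cong G$ and $\pi_n(BG,p)=0$ for all $n\ge 2$ and every base point $p$. 2. $BG\approx (Br\mathcal G)/G$: the functor $r\mathcal G\to G$ that sends each morphism $x\colon a\to b$ to $x^{-1}$ induces a homeomorphism from the orbit space $(Br\mathcal G)/G$, with the quotient topology, onto $BG$. -/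

import Mathlib

open CategoryTheory

universe u

/-- The objects of the groupoid `r𝒢` of the right action of `G` on itself: the elements of `G`. -/
structure RightGroupoid (G : Type u) : Type u where
  /-- the underlying element of `G` -/
  elt : G

namespace RightGroupoid

variable {G : Type u} [Group G]

/-- `Mor(a, b) = {x : a x = b}`; the composite of `x : a → b` and `y : b → c` is `x y`. -/
instance : Groupoid (RightGroupoid G) where
  Hom a b := {x : G // a.elt * x = b.elt}
  id a := ⟨1, mul_one a.elt⟩
  comp {a b c} x y := ⟨x.1 * y.1, by rw [← mul_assoc, x.2, y.2]⟩
  id_comp x := Subtype.ext (one_mul x.1)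
  comp_id x := Subtype.ext (mul_one x.1)
  assoc x y z := Subtype.ext (mul_assoc x.1 y.1 z.1)
  inv {a b} x := ⟨x.1⁻¹, mul_inv_eq_of_eq_mul x.2.symm⟩
  inv_comp x := Subtype.ext (inv_mul_cancel x.1)
  comp_inv x := Subtype.ext (mul_inv_cancel x.1)

/-- Left translation by `h : G`: it sends the object `a` to `h a` and the morphism
`x : a → b` to the morphism `x : h a → h b`. -/
def translate (h : G) : RightGroupoid G ⥤ RightGroupoid G where
  obj a := ⟨h * a.elt⟩
  map {a b} x := ⟨x.1, by rw [mul_assoc, x.2]⟩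

theorem hom_eq {a b : RightGroupoid G} (x y : a ⟶ b) : x = y :=
  Subtype.ext (mul_left_cancel (x.2.trans y.2.symm))

theorem translate_one : translate (1 : G) = 𝟭 (RightGroupoid G) :=
  CategoryTheory.Functor.ext (fun a ↦ congrArg mk (one_mul a.elt)) fun _ _ _ ↦ hom_eq _ _

theorem translate_mul (h k : G) : translate (h * k) = translate k ⋙ translate h :=
  CategoryTheory.Functor.ext (fun a ↦ congrArg mk (mul_assoc h k a.elt)) fun _ _ _ ↦ hom_eq _ _

/-- The projection of `r𝒢` onto `G` as a one-object category. In `SingleObj G` the composite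
of `x` followed by `y` is `y x`, so the morphism `x : a → b` is sent to `x⁻¹`. -/
def proj (G : Type u) [Group G] : RightGroupoid G ⥤ SingleObj G where
  obj _ := SingleObj.star G
  map x := (x.1⁻¹ : G)
  map_id _ := inv_one
  map_comp x y := mul_inv_rev x.1 y.1

/-- The map of nerves induced by `proj`. -/
def nerveProj (G : Type u) [Group G] : nerve (RightGroupoid G) ⟶ nerve (SingleObj G) where
  app _ := ↾fun (σ : ComposableArrows (RightGroupoid G) _) ↦ σ ⋙ proj G

end RightGroupoid

/-- The classifying space of a category: the geometric realization of its nerve. -/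
noncomputable abbrev classifyingSpace (C : Type*) [Category C] : TopCat :=
  SSet.toTop.obj (nerve C)

/-- The classifying space `Br𝒢`. -/
noncomputable def BrG (G : Type u) [Group G] : TopCat.{u} :=
  classifyingSpace (RightGroupoid G)

/-- The classifying space `BG` of the group `G`, viewed as a category with one object. -/
noncomputable def BG (G : Type u) [Group G] : TopCat.{u} :=
  classifyingSpace (SingleObj G)

/-- The action of `G` on `Br𝒢` induced by left translations of the groupoid `r𝒢`. -/
noncomputable instance (G : Type u) [Group G] : MulAction G (BrG G) where
  smul h p := (SSet.toTop.map (nerveMap (RightGroupoid.translate h))).hom p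
  one_smul p := by
    change (SSet.toTop.map (nerveMap (RightGroupoid.translate (1 : G)))).hom p = p
    rw [RightGroupoid.translate_one]
    exact congrArg (fun f ↦ f.hom p) (SSet.toTop.map_id (nerve (RightGroupoid G)))
  mul_smul h k p := by
    change (SSet.toTop.map (nerveMap (RightGroupoid.translate (h * k)))).hom p =
      (SSet.toTop.map (nerveMap (RightGroupoid.translate h))).hom
        ((SSet.toTop.map (nerveMap (RightGroupoid.translate k))).hom p)
    rw [RightGroupoid.translate_mul]
    exact congrArg (fun f ↦ f.hom p) (SSet.toTop.map_comp
      (nerveMap (RightGroupoid.translate k)) (nerveMap (RightGroupoid.translate h)))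

/-- The map `Br𝒢 → BG` induced by the projection of `r𝒢` onto the one-object category `G`. -/
noncomputable def BrG.toBG (G : Type u) [Group G] : C(BrG G, BG G) :=
  (SSet.toTop.map (RightGroupoid.nerveProj G)).hom

/-- `X` is an Eilenberg–MacLane complex of type `K(G, 1)`: a path connected CW complex with
fundamental group isomorphic to `G` and with trivial higher homotopy groups. -/
structure IsEilenbergMacLaneOne (G : Type u) [Group G] (X : TopCat.{u}) : Prop where
  cwComplex : Nonempty (TopCat.CWComplex X)
  pathConnected : PathConnectedSpace X
  pi_one (x : X) : Nonempty (HomotopyGroup.Pi 1 X x ≃* G)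
  pi_higher (n : ℕ) (hn : 2 ≤ n) (x : X) : Subsingleton (HomotopyGroup.Pi n X x)

/-! In `r𝒢` there is exactly one morphism between any two objects, so every object is initial and
`Br𝒢` is contractible. A simplex of the nerve of `r𝒢` is the sequence of its vertices, and it is
determined up to a left translation by its image in the nerve of `G`; hence in every degree the
nerve of `G` is the quotient of the nerve of `r𝒢`. Geometric realization, being a left adjoint,
turns this into a homeomorphism `(Br𝒢)/G ≃ BG`.

`G` permutes the vertices of `r𝒢` freely. At every point of `Br𝒢` some vertex `v` carries more than
half of the total weight of all vertices, for a suitable weight (see `Realization.weight`), and the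
points with this property for `v` form a neighbourhood that is disjoint from all its translates.
So `Br𝒢 → BG` is a covering with group `G` and contractible total space. It follows that
`π₁(BG) ≅ G` (up to passing to the opposite group, hence the inversion) and, lifting cubes, that
the higher homotopy groups vanish. Finally, the realization of any simplicial set is a CW complex,
because `∂Δⁿ ⊆ Δⁿ` realizes to a sphere in a ball. -/

theorem stdSimplex_map_apply {ι κ : Type*} [Fintype ι] [Fintype κ] [DecidableEq κ] (f : ι → κ)
    (t : stdSimplex ℝ ι) (i : κ) : stdSimplex.map f t i = ∑ j with f j = i, t j := by
  rw [stdSimplex.map_coe, FunOnFinite.linearMap_apply_apply]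

section Realization

open Simplicial Opposite

namespace Realization

variable {X Y : SSet.{u}} {Z : Type u} [TopologicalSpace Z] {m n : SimplexCategory}

/-- The characteristic map `Δⁿ → |X|` of an `n`-simplex `σ` of `X`. -/
noncomputable def charMap (σ : X.obj (op n)) : C(stdSimplex ℝ (Fin (n.len + 1)), |X|) :=
  TopCat.toSSetObjEquiv |X| (op n) ((sSetTopAdj.unit.app X).app (op n) σ)

theorem charMap_map (f : m ⟶ n) (σ : X.obj (op n)) (t : stdSimplex ℝ (Fin (m.len + 1))) :
    charMap (X.map f.op σ) t = charMap σ (stdSimplex.map f t) := by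
  have h := NatTrans.naturality_apply (sSetTopAdj.unit.app X) f.op σ
  exact congrArg (fun τ ↦ TopCat.toSSetObjEquiv |X| (op m) τ t) h

theorem toTop_map_charMap (g : X ⟶ Y) (σ : X.obj (op n)) (t : stdSimplex ℝ (Fin (n.len + 1))) :
    (SSet.toTop.map g).hom (charMap σ t) = charMap (g.app (op n) σ) t := by
  have h := ConcreteCategory.congr_hom (NatTrans.congr_app (sSetTopAdj.unit.naturality g) (op n)) σ
  exact (congrArg (fun τ ↦ TopCat.toSSetObjEquiv |Y| (op n) τ t) h).symm

theorem hom_ext {f g : C(|X|, Z)}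
    (h : ∀ (n : SimplexCategory) (σ : X.obj (op n)), f.comp (charMap σ) = g.comp (charMap σ)) :
    f = g := by
  have : (TopCat.ofHom f : |X| ⟶ TopCat.of Z) = TopCat.ofHom g := by
    apply (sSetTopAdj.homEquiv X (TopCat.of Z)).injective
    rw [Adjunction.homEquiv_unit, Adjunction.homEquiv_unit]
    ext ⟨n⟩ σ
    exact (TopCat.toSSetObjEquiv (TopCat.of Z) (op n)).injective (h n σ)
  exact congrArg TopCat.Hom.hom this

-- The union of the images and `|X|` have the same indicator function by `hom_ext`, applied to maps
-- into an indiscrete space.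
theorem exists_charMap_eq (p : |X|) :
    ∃ (n : SimplexCategory) (σ : X.obj (op n)) (t : stdSimplex ℝ (Fin (n.len + 1))),
      charMap σ t = p := by
  let _ : TopologicalSpace (ULift.{u} Prop) := ⊤
  let inImage : C(|X|, ULift.{u} Prop) := ⟨fun p ↦ ⟨∃ (n : SimplexCategory) (σ : X.obj (op n))
    (t : stdSimplex ℝ (Fin (n.len + 1))), charMap σ t = p⟩, continuous_top⟩
  let constTrue : C(|X|, ULift.{u} Prop) := ⟨fun _ ↦ ⟨True⟩, continuous_top⟩
  have h : inImage = constTrue := hom_ext fun n σ ↦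
    ContinuousMap.ext fun t ↦ congrArg ULift.up (eq_true ⟨n, σ, t, rfl⟩)
  exact of_eq_true (congrArg ULift.down (DFunLike.congr_fun h p))

/-- The simplicial map to the singular simplicial set of `Z` given by a compatible family of maps
out of the topological simplices, one for each simplex of `X`. -/
noncomputable def toSingular (φ : ∀ n, X.obj (op n) → C(stdSimplex ℝ (Fin (n.len + 1)), Z))
    (hφ : ∀ ⦃m n⦄ (f : m ⟶ n) (σ : X.obj (op n)) t,
      φ m (X.map f.op σ) t = φ n σ (stdSimplex.map f t)) :
    X ⟶ TopCat.toSSet.obj (TopCat.of Z) where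
  app n := ↾fun σ ↦ (TopCat.toSSetObjEquiv (TopCat.of Z) n).symm (φ n.unop σ)
  naturality n m f := by
    ext σ
    apply (TopCat.toSSetObjEquiv (TopCat.of Z) m).injective
    ext t
    exact hφ f.unop σ t

/-- The continuous map out of `|X|` given by a compatible family of maps out of the topological
simplices, one for each simplex of `X`. -/
noncomputable def desc (φ : ∀ n, X.obj (op n) → C(stdSimplex ℝ (Fin (n.len + 1)), Z))
    (hφ : ∀ ⦃m n⦄ (f : m ⟶ n) (σ : X.obj (op n)) t,
      φ m (X.map f.op σ) t = φ n σ (stdSimplex.map f t)) :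
    C(|X|, Z) :=
  ((sSetTopAdj.homEquiv X (TopCat.of Z)).symm (toSingular φ hφ)).hom

theorem desc_charMap (φ : ∀ n, X.obj (op n) → C(stdSimplex ℝ (Fin (n.len + 1)), Z))
    (hφ : ∀ ⦃m n⦄ (f : m ⟶ n) (σ : X.obj (op n)) t,
      φ m (X.map f.op σ) t = φ n σ (stdSimplex.map f t))
    (σ : X.obj (op n)) (t : stdSimplex ℝ (Fin (n.len + 1))) :
    desc φ hφ (charMap σ t) = φ n σ t := by
  have h := (Adjunction.homEquiv_unit ..).symm.trans
    ((sSetTopAdj.homEquiv X (TopCat.of Z)).apply_symm_apply (toSingular φ hφ))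
  exact congrArg (fun ψ ↦ TopCat.toSSetObjEquiv (TopCat.of Z) (op n) (ψ.app (op n) σ) t) h

theorem toTopHomeo_charMap (σ : (SSet.stdSimplex.{u}.obj n).obj (op m))
    (t : stdSimplex ℝ (Fin (m.len + 1))) :
    n.toTopHomeo (charMap σ t) = stdSimplex.map (SSet.stdSimplex.objEquiv σ) t := by
  have hσ : SSet.yonedaEquiv.symm σ = SSet.stdSimplex.map (SSet.stdSimplex.objEquiv σ) := by
    apply SSet.yonedaEquiv.injective
    rw [Equiv.apply_symm_apply, SSet.yonedaEquiv_map]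
    exact (Equiv.symm_apply_apply _ _).symm
  have hchar := sSetTopAdj_unit_app_app_down (SSet.stdSimplex.{u}.obj n) (op m) σ
  rw [hσ] at hchar
  calc n.toTopHomeo (charMap σ t)
    _ = n.toTopHomeo (SSet.toTop.map (SSet.stdSimplex.map (SSet.stdSimplex.objEquiv σ))
          (m.toTopHomeo.symm t)) :=
        congrArg n.toTopHomeo (ConcreteCategory.congr_hom hchar (ULift.up t))
    _ = stdSimplex.map (SSet.stdSimplex.objEquiv σ) t := by
        rw [SimplexCategory.toTopHomeo_naturality_apply, Homeomorph.apply_symm_apply]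

end Realization

end Realization

section Orbits

open Simplicial Opposite

/-- The simplicial map `q : X ⟶ Y` exhibits `Y` as the levelwise quotient of `X` by the self-maps
`ρ h` of `X`. -/
structure IsOrbitMap {G : Type*} {X Y : SSet.{u}} (ρ : G → (X ⟶ X)) (q : X ⟶ Y) : Prop where
  surjective (n : SimplexCategory) : Function.Surjective (q.app (op n))
  app_eq_app_iff {n : SimplexCategory} {σ σ' : X.obj (op n)} :
    q.app (op n) σ = q.app (op n) σ' ↔ ∃ h, (ρ h).app (op n) σ = σ'

namespace Realization

variable {X Y : SSet.{u}} {q : X ⟶ Y}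

theorem toTop_map_surjective (hq : ∀ n, Function.Surjective (q.app (op n))) :
    Function.Surjective (SSet.toTop.map q).hom := by
  intro p
  obtain ⟨n, τ, t, rfl⟩ := exists_charMap_eq p
  obtain ⟨σ, rfl⟩ := hq n τ
  exact ⟨charMap σ t, toTop_map_charMap q σ t⟩

theorem exists_comp_toTop_map_eq (hq : ∀ n, Function.Surjective (q.app (op n)))
    {Z : Type u} [TopologicalSpace Z] (f : C(|X|, Z))
    (hf : ∀ {n} {σ σ' : X.obj (op n)}, q.app (op n) σ = q.app (op n) σ' →
      f.comp (charMap σ) = f.comp (charMap σ')) :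
    ∃ g : C(|Y|, Z), g.comp (SSet.toTop.map q).hom = f := by
  choose lift q_lift using hq
  let g : C(|Y|, Z) := desc (fun n τ ↦ f.comp (charMap (lift n τ))) fun m n a τ t ↦ by
    have hq_map : q.app (op m) (lift m (Y.map a.op τ)) =
        q.app (op m) (X.map a.op (lift n τ)) := by
      rw [q_lift, NatTrans.naturality_apply, q_lift]
    calc f (charMap (lift m (Y.map a.op τ)) t)
      _ = f (charMap (X.map a.op (lift n τ)) t) := DFunLike.congr_fun (hf hq_map) t
      _ = f (charMap (lift n τ) (stdSimplex.map a t)) := congrArg f (charMap_map a _ t)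
  refine ⟨g, hom_ext fun n σ ↦ ContinuousMap.ext fun t ↦ ?_⟩
  calc g ((SSet.toTop.map q).hom (charMap σ t))
    _ = g (charMap (q.app (op n) σ) t) := congrArg g (toTop_map_charMap q σ t)
    _ = f (charMap (lift n (q.app (op n) σ)) t) := desc_charMap ..
    _ = f (charMap σ t) := DFunLike.congr_fun (hf (q_lift n _)) t

variable {G : Type*} [Group G] [MulAction G |X|] {ρ : G → (X ⟶ X)}

theorem smul_charMap (hρ : ∀ (h : G) (p : |X|), h • p = (SSet.toTop.map (ρ h)).hom p) (h : G)
    {n : SimplexCategory} (σ : X.obj (op n)) (t : stdSimplex ℝ (Fin (n.len + 1))) :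
    h • charMap σ t = charMap ((ρ h).app (op n) σ) t :=
  (hρ h _).trans (toTop_map_charMap _ σ t)

theorem toTop_map_smul (hρ : ∀ (h : G) (p : |X|), h • p = (SSet.toTop.map (ρ h)).hom p)
    (hq : IsOrbitMap ρ q) (h : G) (p : |X|) :
    (SSet.toTop.map q).hom (h • p) = (SSet.toTop.map q).hom p := by
  obtain ⟨n, σ, t, rfl⟩ := exists_charMap_eq p
  have hσ : q.app (op n) σ = q.app (op n) ((ρ h).app (op n) σ) := hq.app_eq_app_iff.mpr ⟨h, rfl⟩
  rw [smul_charMap hρ, toTop_map_charMap, toTop_map_charMap, hσ]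

theorem exists_orbitHomeomorph
    (hρ : ∀ (h : G) (p : |X|), h • p = (SSet.toTop.map (ρ h)).hom p) (hq : IsOrbitMap ρ q) :
    ∃ e : MulAction.orbitRel.Quotient G |X| ≃ₜ |Y|,
      ∀ p, e (Quotient.mk _ p) = (SSet.toTop.map q).hom p := by
  let toOrbit : C(|X|, MulAction.orbitRel.Quotient G |X|) :=
    ⟨Quotient.mk _, continuous_quotient_mk'⟩
  let ofOrbit : C(MulAction.orbitRel.Quotient G |X|, |Y|) :=
    ⟨Quotient.lift (SSet.toTop.map q).hom
      (by rintro _ p ⟨h, rfl⟩; exact toTop_map_smul hρ hq h p),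
      (SSet.toTop.map q).hom.continuous.quotient_lift _⟩
  obtain ⟨g, hg⟩ : ∃ g : C(|Y|, MulAction.orbitRel.Quotient G |X|),
      g.comp (SSet.toTop.map q).hom = toOrbit := by
    refine exists_comp_toTop_map_eq hq.surjective toOrbit fun {n σ σ'} hσ ↦ ?_
    obtain ⟨h, rfl⟩ := hq.app_eq_app_iff.mp hσ
    refine ContinuousMap.ext fun t ↦ Quotient.sound ⟨h⁻¹, ?_⟩
    exact (congrArg (h⁻¹ • ·) (smul_charMap hρ h σ t).symm).trans (inv_smul_smul h _)
  refine ⟨⟨⟨ofOrbit, g, Quotient.ind fun p ↦ DFunLike.congr_fun hg p,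
    (toTop_map_surjective hq.surjective).forall.mpr fun p ↦ ?_⟩,
    ofOrbit.continuous, g.continuous⟩, fun _ ↦ rfl⟩
  exact congrArg ofOrbit (DFunLike.congr_fun hg p)

end Realization

end Orbits

section Increments

variable {ι κ M A : Type*} [AddCommMonoid M] [AddCommGroup A]
  [LinearOrder ι] [LocallyFiniteOrderBot ι] [LinearOrder κ] [LocallyFiniteOrderBot κ]

/-- The increment of `F` over the `i`-th of the consecutive intervals of lengths `t j`, starting
at `0`. -/
def increment (F : M → A) (t : ι → M) (i : ι) : A :=
  F (∑ j ∈ Finset.Iic i, t j) - F (∑ j ∈ Finset.Iio i, t j)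

theorem sum_increment_of_isLowerSet (F : M → A) (t : ι → M) {D : Finset ι}
    (hD : IsLowerSet (D : Set ι)) : ∑ i ∈ D, increment F t i = F (∑ i ∈ D, t i) - F 0 := by
  induction D using Finset.induction_on_max with
  | empty => simp
  | insert a s hlt ih =>
    have ha : a ∉ s := fun h ↦ (hlt a h).false
    obtain rfl : s = Finset.Iio a := Finset.Subset.antisymm
      (fun x hx ↦ Finset.mem_Iio.mpr (hlt x hx)) fun x hx ↦ by
        have hxa := Finset.mem_Iio.mp hx
        exact (Finset.mem_insert.mp (hD hxa.le (Finset.mem_insert_self a _))).resolve_left hxa.ne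
    rw [Finset.sum_insert ha, ih (by simpa using isLowerSet_Iio a), increment, Finset.Iio_insert]
    exact sub_add_sub_cancel _ _ _

theorem increment_sum_fiber [Fintype κ] (F : M → A) {f : κ → ι} (hf : Monotone f) (t : κ → M)
    (i : ι) :
    increment F (fun i ↦ ∑ j with f j = i, t j) i = ∑ j with f j = i, increment F t j := by
  have sum_of_isLowerSet (D : Finset ι) (hD : IsLowerSet (D : Set ι)) :
      F (∑ i ∈ D, ∑ j with f j = i, t j) - F 0 = ∑ i ∈ D, ∑ j with f j = i, increment F t j := by
    rw [Finset.sum_fiberwise_eq_sum_filter, Finset.sum_fiberwise_eq_sum_filter,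
      sum_increment_of_isLowerSet]
    exact fun x y hyx hx ↦ by simpa using hD (hf hyx) (by simpa using hx)
  have hIic := sum_of_isLowerSet (Finset.Iic i) (by simpa using isLowerSet_Iic i)
  have hIio := sum_of_isLowerSet (Finset.Iio i) (by simpa using isLowerSet_Iio i)
  rw [increment, ← sub_sub_sub_cancel_right _ _ (F 0), hIic, hIio, ← Finset.Iio_insert,
    Finset.sum_insert (by simp), add_sub_cancel_right]

theorem increment_nonneg [PartialOrder M] [IsOrderedAddMonoid M] [PartialOrder A]
    [IsOrderedAddMonoid A] {F : M → A} (hF : Monotone F) {t : ι → M} (ht : ∀ i, 0 ≤ t i) (i : ι) :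
    0 ≤ increment F t i :=
  sub_nonneg.mpr <| hF <| Finset.sum_le_sum_of_subset_of_nonneg
    (fun _ hj ↦ Finset.mem_Iic.mpr (Finset.mem_Iio.mp hj).le) fun j _ _ ↦ ht j

theorem continuous_increment [TopologicalSpace M] [ContinuousAdd M] [TopologicalSpace A]
    [IsTopologicalAddGroup A] {F : M → A} (hF : Continuous F) (i : ι) :
    Continuous fun t : ι → M ↦ increment F t i := by
  unfold increment
  fun_prop

end Increments

section Weights

open Simplicial Opposite

namespace Realization

variable {X Y : SSet.{u}} {m n : SimplexCategory}

/-- The `i`-th vertex of the simplex `σ`. -/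
def vertex (σ : X.obj (op n)) (i : Fin (n.len + 1)) : X.obj (op ⦋0⦌) :=
  X.map (SimplexCategory.const ⦋0⦌ n i).op σ

theorem vertex_map (f : m ⟶ n) (σ : X.obj (op n)) (i : Fin (m.len + 1)) :
    vertex (X.map f.op σ) i = vertex σ (f i) :=
  (ConcreteCategory.congr_hom (X.map_comp f.op (SimplexCategory.const ⦋0⦌ m i).op) σ).symm

theorem vertex_app (g : X ⟶ Y) (σ : X.obj (op n)) (i : Fin (n.len + 1)) :
    vertex (g.app (op n) σ) i = g.app (op ⦋0⦌) (vertex σ i) :=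
  (NatTrans.naturality_apply g _ σ).symm

open Classical in
theorem sum_increment_vertex_map (F : ℝ → ℝ) (v : X.obj (op ⦋0⦌)) (f : m ⟶ n) (σ : X.obj (op n))
    (t : stdSimplex ℝ (Fin (m.len + 1))) :
    ∑ j with vertex (X.map f.op σ) j = v, increment F t j =
      ∑ i with vertex σ i = v, increment F (stdSimplex.map f t) i := by
  have increment_map (i : Fin (n.len + 1)) :
      increment F (stdSimplex.map f t) i = ∑ j with f j = i, increment F t j :=
    funext (stdSimplex_map_apply f t) ▸ increment_sum_fiber F f.toOrderHom.monotone t i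
  simp only [vertex_map, increment_map, Finset.sum_fiberwise_eq_sum_filter, Finset.mem_filter,
    Finset.mem_univ, true_and]

open Classical in
/-- A point of the simplex `σ` with barycentric coordinates `t` gives the step function on `[0, 1]`
whose value on the `i`-th of the consecutive intervals of lengths `t i` is the `i`-th vertex of
`σ`. This is the total increment of `F` over the set where this step function has the value `v`. -/
noncomputable def weight (F : C(ℝ, ℝ)) (v : X.obj (op ⦋0⦌)) : C(|X|, ℝ) :=
  ContinuousMap.comp ⟨ULift.down, continuous_uliftDown⟩ <| desc (Z := ULift.{u} ℝ)
    (fun _ σ ↦ ⟨fun t ↦ ⟨∑ i with vertex σ i = v, increment F t i⟩,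
      continuous_uliftUp.comp <| continuous_finsetSum _ fun i _ ↦
        (continuous_increment F.continuous i).comp continuous_subtype_val⟩)
    fun _ _ f σ t ↦ congrArg ULift.up (sum_increment_vertex_map F v f σ t)

open Classical in
theorem weight_charMap (F : C(ℝ, ℝ)) (v : X.obj (op ⦋0⦌)) (σ : X.obj (op n))
    (t : stdSimplex ℝ (Fin (n.len + 1))) :
    weight F v (charMap σ t) = ∑ i with vertex σ i = v, increment F t i :=
  congrArg ULift.down (desc_charMap (Z := ULift.{u} ℝ) _ _ σ t)

variable {F : C(ℝ, ℝ)}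

theorem weight_le_weight_toTop_map (hF : Monotone F) (g : X ⟶ Y) (v : X.obj (op ⦋0⦌)) (p : |X|) :
    weight F v p ≤ weight F (g.app (op ⦋0⦌) v) ((SSet.toTop.map g).hom p) := by
  classical
  obtain ⟨n, σ, t, rfl⟩ := exists_charMap_eq p
  rw [toTop_map_charMap, weight_charMap, weight_charMap]
  refine Finset.sum_le_sum_of_subset_of_nonneg (fun i hi ↦ ?_)
    fun i _ _ ↦ increment_nonneg hF t.2.1 i
  simp only [Finset.mem_filter, Finset.mem_univ, true_and] at hi ⊢
  rw [vertex_app, hi]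

theorem weight_add_weight_le (hF : Monotone F) {v w : X.obj (op ⦋0⦌)} (hvw : v ≠ w) (p : |X|) :
    weight F v p + weight F w p ≤ F 1 - F 0 := by
  classical
  obtain ⟨n, σ, t, rfl⟩ := exists_charMap_eq p
  have hdisj : Disjoint (Finset.univ.filter (vertex σ · = v))
      (Finset.univ.filter (vertex σ · = w)) :=
    Finset.disjoint_filter.mpr fun i _ hv hw ↦ hvw (hv.symm.trans hw)
  calc weight F v (charMap σ t) + weight F w (charMap σ t)
    _ = ∑ i ∈ Finset.univ.filter (vertex σ · = v) ∪ Finset.univ.filter (vertex σ · = w),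
          increment F t i := by
        rw [weight_charMap, weight_charMap, Finset.sum_union hdisj]
    _ ≤ ∑ i, increment F t i := Finset.sum_le_sum_of_subset_of_nonneg (Finset.subset_univ _)
        fun i _ _ ↦ increment_nonneg hF t.2.1 i
    _ = F 1 - F 0 := by
        rw [sum_increment_of_isLowerSet _ _ (by simpa using isLowerSet_univ),
          stdSimplex.sum_eq_one]

theorem exists_lt_two_mul_weight (p : |X|) :
    ∃ F : C(ℝ, ℝ), Monotone F ∧ ∃ v, F 1 - F 0 < 2 * weight F v p := by
  classical
  obtain ⟨n, σ, t, rfl⟩ := exists_charMap_eq p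
  obtain ⟨i, hi⟩ : ∃ i, 0 < t i := by
    by_contra! h
    linarith [stdSimplex.sum_eq_one t, Finset.sum_nonpos fun i (_ : i ∈ Finset.univ) ↦ h i]
  set a := ∑ j ∈ Finset.Iio i, t j
  set b := ∑ j ∈ Finset.Iic i, t j with hb
  have hab : a < b := by
    rw [hb, ← Finset.Iio_insert, Finset.sum_insert (by simp)]
    linarith
  let clamp : C(ℝ, ℝ) := ⟨fun x ↦ max a (min b x), by fun_prop⟩
  have clamp_mono : Monotone clamp := fun x y hxy ↦ max_le_max le_rfl (min_le_min le_rfl hxy)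
  have clamp_sub_le : clamp 1 - clamp 0 ≤ b - a :=
    sub_le_sub (max_le hab.le (min_le_left _ _)) (le_max_left _ _)
  have increment_eq : increment clamp t i = b - a := by
    change max a (min b b) - max a (min b a) = b - a
    rw [min_self, min_eq_right hab.le, max_self, max_eq_right hab.le]
  have le_weight : b - a ≤ weight clamp (vertex σ i) (charMap σ t) := by
    rw [weight_charMap, ← increment_eq]
    exact Finset.single_le_sum (fun j _ ↦ increment_nonneg clamp_mono t.2.1 j)
      (Finset.mem_filter.mpr ⟨Finset.mem_univ i, rfl⟩)
  exact ⟨clamp, clamp_mono, vertex σ i, by linarith⟩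

variable {G : Type*} [Group G] [MulAction G |X|] {ρ : G → (X ⟶ X)} {q : X ⟶ Y}

theorem isQuotientCoveringMap_toTop_map
    (hρ : ∀ (h : G) (p : |X|), h • p = (SSet.toTop.map (ρ h)).hom p) (hq : IsOrbitMap ρ q)
    (hfree : ∀ (h : G) (v : X.obj (op ⦋0⦌)), (ρ h).app (op ⦋0⦌) v = v → h = 1) :
    IsQuotientCoveringMap (SSet.toTop.map q).hom G := by
  obtain ⟨e, he⟩ := exists_orbitHomeomorph hρ hq
  refine ⟨?_, ⟨fun h ↦ ?_⟩, fun {p p'} ↦ ?_, fun p ↦ ?_⟩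
  · exact (funext he : e ∘ Quotient.mk _ = _) ▸ e.isQuotientMap.comp isQuotientMap_quotient_mk'
  · exact (funext (hρ h) : (h • · : |X| → |X|) = _) ▸ (SSet.toTop.map (ρ h)).hom.continuous
  · rw [← he, ← he, e.injective.eq_iff]
    exact Quotient.eq''
  · obtain ⟨F, hF, v, hv⟩ := exists_lt_two_mul_weight p
    refine ⟨{p | F 1 - F 0 < 2 * weight F v p},
      (isOpen_lt (by fun_prop) (by fun_prop)).mem_nhds hv, ?_⟩
    rintro h ⟨_, ⟨r, hr, rfl⟩, hr'⟩
    refine hfree h v (by_contra fun hne ↦ ?_)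
    have h_sum := weight_add_weight_le hF hne (h • r)
    have h_le := weight_le_weight_toTop_map hF (ρ h) v r
    rw [← hρ] at h_le
    simp only [Set.mem_ofPred_eq] at hr hr'
    linarith

end Realization

end Weights

section InitialObject

open Simplicial Opposite Limits

/-- The extension of `f : m ⟶ n` to a morphism that preserves a new initial vertex. -/
def coneMap {m n : SimplexCategory} (f : m ⟶ n) : ⦋m.len + 1⦌ ⟶ ⦋n.len + 1⦌ :=
  SimplexCategory.Hom.mk
    { toFun := Fin.cons 0 fun i ↦ (f i).succ
      monotone' := by
        refine Fin.cases (fun _ _ ↦ Fin.zero_le _) fun i ↦ Fin.cases (fun h ↦ ?_) fun j h ↦ ?_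
        · simp at h
        · exact Fin.succ_le_succ_iff.mpr (f.toOrderHom.monotone (Fin.succ_le_succ_iff.mp h)) }

/-- The face opposite to a new initial vertex. -/
def coneFace (n : SimplexCategory) : n ⟶ ⦋n.len + 1⦌ :=
  SimplexCategory.Hom.mk (Fin.succOrderEmb (n.len + 1)).toOrderHom

/-- The point that divides the segment from a new initial vertex to `t` in the ratio `1 - s : s`. -/
def conePoint {m : ℕ} (t : stdSimplex ℝ (Fin m)) (s : unitInterval) : stdSimplex ℝ (Fin (m + 1)) :=
  ⟨Fin.cons (s : ℝ) fun i ↦ (1 - s) * t i,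
    Fin.cases s.2.1 fun i ↦ mul_nonneg (sub_nonneg.mpr s.2.2) (t.2.1 i), by
    simp [Fin.sum_univ_succ, ← Finset.mul_sum]⟩

theorem conePoint_apply_zero {m : ℕ} (t : stdSimplex ℝ (Fin m)) (s : unitInterval) :
    conePoint t s 0 = s := rfl

theorem conePoint_apply_succ {m : ℕ} (t : stdSimplex ℝ (Fin m)) (s : unitInterval) (i : Fin m) :
    conePoint t s i.succ = (1 - s) * t i := rfl

theorem continuous_conePoint {m : ℕ} :
    Continuous fun x : stdSimplex ℝ (Fin m) × unitInterval ↦ conePoint x.1 x.2 := by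
  refine Continuous.subtype_mk (continuous_pi (Fin.cases ?_ fun i ↦ ?_)) _
  · exact continuous_subtype_val.comp continuous_snd
  · exact (continuous_const.sub (continuous_subtype_val.comp continuous_snd)).mul
      ((continuous_apply i).comp (continuous_subtype_val.comp continuous_fst))

theorem map_coneMap_conePoint {m n : SimplexCategory} (f : m ⟶ n)
    (t : stdSimplex ℝ (Fin (m.len + 1))) (s : unitInterval) :
    stdSimplex.map (coneMap f) (conePoint t s) = conePoint (stdSimplex.map f t) s := by
  have coneMap_zero : coneMap f 0 = 0 := rfl
  have coneMap_succ (i) : coneMap f i.succ = (f i).succ := rfl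
  refine stdSimplex.ext (funext fun i ↦ (stdSimplex_map_apply ..).trans ?_)
  rw [Finset.sum_filter, Fin.sum_univ_succ]
  cases i using Fin.cases with
  | zero => simp [conePoint_apply_zero, coneMap_zero, coneMap_succ]
  | succ i =>
    simp [conePoint_apply_succ, coneMap_zero, coneMap_succ, (Fin.succ_ne_zero i).symm,
      stdSimplex_map_apply, Finset.mul_sum, Finset.sum_filter]

theorem conePoint_zero {m : ℕ} (t : stdSimplex ℝ (Fin m)) :
    conePoint t 0 = stdSimplex.map Fin.succ t := by
  refine stdSimplex.ext (funext fun i ↦ ?_)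
  rw [stdSimplex_map_apply, Finset.sum_filter]
  cases i using Fin.cases with
  | zero => simp [conePoint_apply_zero]
  | succ i => simp [conePoint_apply_succ]

theorem conePoint_one {m : ℕ} (t : stdSimplex ℝ (Fin m)) :
    conePoint t 1 = stdSimplex.vertex 0 := by
  refine stdSimplex.ext (funext fun i ↦ ?_)
  cases i using Fin.cases with
  | zero => simp [conePoint_apply_zero]
  | succ i => simp [conePoint_apply_succ]

namespace Realization

variable {C : Type*} [Category* C] [HasInitial C] {m n : SimplexCategory}

/-- The simplex of the nerve of `C` whose vertices are the initial object and the vertices of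
`σ`. -/
noncomputable def coneSimplex (σ : (nerve C).obj (op n)) : (nerve C).obj (op ⦋n.len + 1⦌) :=
  ComposableArrows.precomp σ (initial.to (σ.obj 0))

theorem coneSimplex_map (f : m ⟶ n) (σ : (nerve C).obj (op n)) :
    coneSimplex ((nerve C).map f.op σ) = (nerve C).map (coneMap f).op (coneSimplex σ) :=
  ComposableArrows.ext_succ rfl rfl (initial.hom_ext _ _)

theorem map_coneFace_coneSimplex (σ : (nerve C).obj (op n)) :
    (nerve C).map (coneFace n).op (coneSimplex σ) = σ :=
  rfl

theorem vertex_zero_coneSimplex (σ : (nerve C).obj (op n)) :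
    vertex (coneSimplex σ) 0 = ComposableArrows.mk₀ (⊥_ C) :=
  ComposableArrows.ext₀ rfl

variable (C) in
/-- The homotopy from the identity to the constant map at the initial object that moves each point
of a simplex along a segment in the cone on this simplex. -/
noncomputable def contraction : C(classifyingSpace C, C(unitInterval, classifyingSpace C)) :=
  desc
    (fun _ σ ↦ ContinuousMap.curry ((charMap (n := ⦋_⦌) (coneSimplex σ)).comp
      ⟨fun x ↦ conePoint x.1 x.2, continuous_conePoint⟩))
    fun _ _ f σ t ↦ ContinuousMap.ext fun s ↦ by
      change charMap (n := ⦋_⦌) (coneSimplex _) (conePoint t s) =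
        charMap (n := ⦋_⦌) (coneSimplex σ) (conePoint (stdSimplex.map f t) s)
      rw [coneSimplex_map, charMap_map, map_coneMap_conePoint]

theorem contraction_charMap (σ : (nerve C).obj (op n)) (t : stdSimplex ℝ (Fin (n.len + 1)))
    (s : unitInterval) :
    contraction C (charMap σ t) s = charMap (n := ⦋_⦌) (coneSimplex σ) (conePoint t s) :=
  DFunLike.congr_fun (desc_charMap ..) s

theorem contraction_zero (p : classifyingSpace C) : contraction C p 0 = p := by
  obtain ⟨n, σ, t, rfl⟩ := exists_charMap_eq p
  calc contraction C (charMap σ t) 0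
    _ = charMap (n := ⦋_⦌) (coneSimplex σ) (stdSimplex.map (coneFace n) t) := by
        rw [contraction_charMap, conePoint_zero]
        rfl
    _ = charMap σ t := by rw [← charMap_map, map_coneFace_coneSimplex]

theorem contraction_one (p : classifyingSpace C) :
    contraction C p 1 =
      charMap (X := nerve C) (n := ⦋0⦌) (ComposableArrows.mk₀ (⊥_ C)) (stdSimplex.vertex 0) := by
  obtain ⟨n, σ, t, rfl⟩ := exists_charMap_eq p
  rw [contraction_charMap, conePoint_one, ← vertex_zero_coneSimplex σ, vertex, charMap_map,
    stdSimplex.map_vertex]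
  rfl

end Realization

theorem contractibleSpace_classifyingSpace (C : Type*) [Category* C] [HasInitial C] :
    ContractibleSpace (classifyingSpace C) := by
  rw [contractible_iff_id_nullhomotopic]
  exact ⟨_, ⟨{
    toFun := fun x ↦ Realization.contraction C x.2 x.1
    continuous_toFun := by fun_prop
    map_zero_left := Realization.contraction_zero
    map_one_left := Realization.contraction_one }⟩⟩

end InitialObject

section SubcomplexOfSimplex

open Simplicial Opposite

theorem exists_monotone_section {α β : Type*} [LinearOrder α] [LinearOrder β] (f : α →o β)
    {S : Finset α} (hS : S.Nonempty) :
    ∃ s : β →o α, (∀ b, s b ∈ S) ∧ ∀ a ∈ S, f (s (f a)) = f a := by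
  let T (b : β) : Finset α := insert (S.min' hS) (S.filter (f · ≤ b))
  have hT (b) : (T b).Nonempty := Finset.insert_nonempty _ _
  have hTS (b) : T b ⊆ S := Finset.insert_subset (S.min'_mem hS) (Finset.filter_subset _ _)
  have T_mono (b c) (h : b ≤ c) : T b ⊆ T c := Finset.insert_subset_insert _ fun a ha ↦
    Finset.mem_filter.mpr ((Finset.mem_filter.mp ha).imp_right h.trans')
  refine ⟨⟨fun b ↦ (T b).max' (hT b), fun b c h ↦ Finset.max'_subset _ (T_mono b c h)⟩,
    fun b ↦ hTS b (Finset.max'_mem _ (hT b)), fun a ha ↦ le_antisymm ?_ ?_⟩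
  · change f ((T (f a)).max' (hT _)) ≤ f a
    obtain h | h := Finset.mem_insert.mp ((T (f a)).max'_mem (hT _))
    · rw [h]
      exact f.monotone (S.min'_le a ha)
    · exact (Finset.mem_filter.mp h).2
  · exact f.monotone ((T (f a)).le_max' a
      (Finset.mem_insert_of_mem (Finset.mem_filter.mpr ⟨ha, le_rfl⟩)))

theorem stdSimplex_map_apply_ne_zero_iff {ι κ : Type*} [Fintype ι] [Fintype κ] (f : ι → κ)
    (t : stdSimplex ℝ ι) (i : κ) : stdSimplex.map f t i ≠ 0 ↔ ∃ j, f j = i ∧ t j ≠ 0 := by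
  classical
  have ht (j) : 0 ≤ t j := t.2.1 j
  rw [stdSimplex_map_apply, Ne, Finset.sum_eq_zero_iff_of_nonneg fun j _ ↦ ht j]
  simp

theorem stdSimplex_map_eq_self {ι : Type*} [Fintype ι] {f : ι → ι} {t : stdSimplex ℝ ι}
    (h : ∀ i, t i ≠ 0 → f i = i) : stdSimplex.map f t = t := by
  classical
  refine stdSimplex.ext (funext fun i ↦ (stdSimplex_map_apply f t i).trans ?_)
  have hf (j) : (if f j = i then t j else 0) = if j = i then t j else 0 := by
    by_cases hj : t j = 0
    · simp only [hj, ite_self]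
    · rw [h j hj]
  simp [Finset.sum_filter, hf]

theorem exists_section_support {m n : SimplexCategory} (f : m ⟶ n)
    (t : stdSimplex ℝ (Fin (m.len + 1))) :
    ∃ s : n ⟶ m, (∀ i, t (s i) ≠ 0) ∧ ∀ i, stdSimplex.map f t i ≠ 0 → f (s i) = i := by
  have support_nonempty : (Finset.univ.filter fun i ↦ t i ≠ 0).Nonempty := by
    by_contra! h
    have ht (i) : t i = 0 := by simpa using Finset.filter_eq_empty_iff.mp h (Finset.mem_univ i)
    simpa [ht] using (stdSimplex.sum_eq_one t : ∑ i, t i = 1)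
  obtain ⟨s, hs, hfs⟩ := exists_monotone_section f.toOrderHom support_nonempty
  refine ⟨SimplexCategory.Hom.mk s, fun i ↦ (Finset.mem_filter.mp (hs i)).2, fun i hi ↦ ?_⟩
  obtain ⟨j, rfl, hj⟩ := (stdSimplex_map_apply_ne_zero_iff f t i).mp hi
  exact hfs j (Finset.mem_filter.mpr ⟨Finset.mem_univ j, hj⟩)

namespace Realization

variable {m n : SimplexCategory} (A : (SSet.stdSimplex.{u}.obj n).Subcomplex)

/-- The barycentric coordinates of a point of the realization of a subcomplex of a simplex. -/
noncomputable def coordinates : C(|(A : SSet.{u})|, stdSimplex ℝ (Fin (n.len + 1))) :=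
  (n.toTopHomeo : C(_, _)).comp (SSet.toTop.map A.ι).hom

theorem coordinates_charMap (σ : (A : SSet.{u}).obj (op m)) (t : stdSimplex ℝ (Fin (m.len + 1))) :
    coordinates A (charMap σ t) = stdSimplex.map (SSet.stdSimplex.objEquiv σ.1) t :=
  (congrArg n.toTopHomeo (toTop_map_charMap A.ι σ t)).trans (toTopHomeo_charMap σ.1 t)

variable {A}

theorem charMap_coordinates_eq {τ : (A : SSet.{u}).obj (op n)} {p : |(A : SSet.{u})|}
    (h : ∀ i, coordinates A p i ≠ 0 → SSet.stdSimplex.objEquiv τ.1 i = i) :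
    charMap τ (coordinates A p) = p := by
  obtain ⟨m, σ, t, rfl⟩ := exists_charMap_eq p
  rw [coordinates_charMap] at h ⊢
  set f : m ⟶ n := SSet.stdSimplex.objEquiv σ.1
  set θ : n ⟶ n := SSet.stdSimplex.objEquiv τ.1
  obtain ⟨r, hr, hrt⟩ := exists_section_support (𝟙 m) t
  have map_r : stdSimplex.map r t = t :=
    stdSimplex_map_eq_self fun i hi ↦ hrt i (by simpa using! hi)
  have hθ : (r ≫ f) ≫ θ = r ≫ f := by
    ext i : 3
    exact h _ ((stdSimplex_map_apply_ne_zero_iff f t _).mpr ⟨r i, rfl, hr i⟩)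
  have hσ : (A : SSet.{u}).map (r ≫ f).op τ = (A : SSet.{u}).map r.op σ :=
    Subtype.ext (SSet.stdSimplex.objEquiv.injective hθ)
  calc charMap τ (stdSimplex.map f t)
    _ = charMap τ (stdSimplex.map (r ≫ f) t) := by
        conv_lhs => rw [← map_r, stdSimplex.map_comp_apply]
        rfl
    _ = charMap ((A : SSet.{u}).map r.op σ) t := by rw [← charMap_map, hσ]
    _ = charMap σ t := by rw [charMap_map, map_r]

theorem exists_charMap_coordinates_eq (p : |(A : SSet.{u})|) :
    ∃ τ : (A : SSet.{u}).obj (op n),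
      (∀ i, coordinates A p i ≠ 0 → SSet.stdSimplex.objEquiv τ.1 i = i) ∧
        charMap τ (coordinates A p) = p := by
  obtain ⟨m, σ, t, hp⟩ := exists_charMap_eq p
  obtain ⟨s, -, hs⟩ := exists_section_support (SSet.stdSimplex.objEquiv σ.1) t
  have h (i) (hi : coordinates A p i ≠ 0) :
      SSet.stdSimplex.objEquiv ((A : SSet.{u}).map s.op σ).1 i = i :=
    hs i (by rwa [← hp, coordinates_charMap] at hi)
  exact ⟨_, h, charMap_coordinates_eq h⟩

instance : CompactSpace |(A : SSet.{u})| := by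
  have : Finite (n ⟶ n) := Finite.of_injective (fun f ↦ (f : Fin _ → Fin _))
    fun f g h ↦ SimplexCategory.Hom.ext _ _ (OrderHom.ext _ _ h)
  have : Finite ((A : SSet.{u}).obj (op n)) := Finite.of_injective
    (fun τ ↦ SSet.stdSimplex.objEquiv τ.1)
    (SSet.stdSimplex.objEquiv.injective.comp Subtype.val_injective)
  rw [← isCompact_univ_iff, ← Set.iUnion_eq_univ_iff.mpr fun p : |(A : SSet.{u})| ↦
    (exists_charMap_coordinates_eq p).imp fun τ hτ ↦ Set.mem_range.mpr ⟨_, hτ.2⟩]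
  exact isCompact_iUnion fun τ ↦ isCompact_range (charMap τ).continuous

variable (A)

theorem isClosedEmbedding_coordinates : Topology.IsClosedEmbedding (coordinates A) := by
  refine (coordinates A).continuous.isClosedEmbedding fun p p' hp ↦ ?_
  obtain ⟨τ, hτ, h⟩ := exists_charMap_coordinates_eq p
  calc p = charMap τ (coordinates A p) := h.symm
    _ = charMap τ (coordinates A p') := by rw [hp]
    _ = p' := charMap_coordinates_eq (hp ▸ hτ)

theorem mem_range_coordinates_iff (q : stdSimplex ℝ (Fin (n.len + 1))) :
    q ∈ Set.range (coordinates A) ↔ ∃ τ : (A : SSet.{u}).obj (op n),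
      ∀ i, q i ≠ 0 → SSet.stdSimplex.objEquiv τ.1 i = i := by
  constructor
  · rintro ⟨p, rfl⟩
    exact (exists_charMap_coordinates_eq p).imp fun _ ↦ And.left
  · rintro ⟨τ, hτ⟩
    exact ⟨charMap τ q, (coordinates_charMap A τ q).trans (stdSimplex_map_eq_self hτ)⟩

theorem mem_range_coordinates_boundary_iff {n : ℕ} (q : stdSimplex ℝ (Fin (n + 1))) :
    q ∈ Set.range (coordinates (n := ⦋n⦌) (∂Δ[n] : (Δ[n] : SSet.{u}).Subcomplex)) ↔
      ∃ i, q i = 0 := by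
  refine (mem_range_coordinates_iff _ q).trans ⟨fun ⟨τ, hτ⟩ ↦ ?_, fun ⟨i, hi⟩ ↦ ?_⟩
  · by_contra! hq
    exact τ.2 fun i ↦ ⟨i, hτ i (hq i)⟩
  · obtain ⟨s, hs, hsq⟩ := exists_section_support (𝟙 ⦋n⦌) q
    refine ⟨⟨SSet.stdSimplex.objEquiv.symm s, fun h ↦ ?_⟩, fun j hj ↦ ?_⟩
    · obtain ⟨j, hj⟩ := h i
      exact hs j (Eq.trans (congrArg q hj) hi)
    · exact hsq j (by simpa using! hj)

end Realization

end SubcomplexOfSimplex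

section SimplexBall

variable {ι E : Type*} [NormedAddCommGroup E] [NormedSpace ℝ E]

theorem exists_homeomorph_closedBall {K : Set E} (hK : IsCompact K) (hconv : Convex ℝ K)
    (hne : (interior K).Nonempty) :
    ∃ Φ : K ≃ₜ Metric.closedBall (0 : E) 1, ∀ x, ‖(Φ x : E)‖ = 1 ↔ (x : E) ∉ interior K := by
  obtain ⟨h, -, h_closure, h_frontier⟩ :=
    exists_homeomorph_image_interior_closure_frontier_eq_unitBall hconv hne hK.isBounded
  rw [hK.isClosed.closure_eq] at h_closure
  refine ⟨(h.image K).trans (Homeomorph.setCongr h_closure), fun x ↦ ?_⟩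
  change ‖h x‖ = 1 ↔ _
  rw [← mem_sphere_zero_iff_norm, ← h_frontier, h.injective.mem_set_image,
    hK.isClosed.frontier_eq, Set.mem_sdiff, and_iff_right x.2]

/-- The barycentric coordinates on the simplex spanned by an affine basis, as a homeomorphism. -/
noncomputable def convexHullHomeomorph [Fintype ι] [FiniteDimensional ℝ E]
    (b : AffineBasis ι ℝ E) : convexHull ℝ (Set.range b) ≃ₜ stdSimplex ℝ ι where
  toFun x := ⟨fun i ↦ b.coord i x, fun i ↦ b.convexHull_eq_nonneg_coord.subset x.2 i,
    b.sum_coord_apply_eq_one x⟩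
  invFun t := ⟨∑ i, t i • b i, (convex_convexHull ℝ _).sum_mem (fun i _ ↦ t.2.1 i) t.2.2
    fun i _ ↦ subset_convexHull ℝ _ (Set.mem_range_self i)⟩
  left_inv x := Subtype.ext (b.linear_combination_coord_eq_self x)
  right_inv t := stdSimplex.ext <| funext fun i ↦ by
    have ht : ∑ i, t i = 1 := t.2.2
    change b.coord i (∑ i, t i • b i) = t i
    rw [← Finset.univ.affineCombination_eq_linear_combination b t ht]
    exact b.coord_apply_combination_of_mem (Finset.mem_univ i) ht
  continuous_toFun := Continuous.subtype_mk (continuous_pi fun i ↦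
    (continuous_barycentric_coord b i).comp continuous_subtype_val) _
  continuous_invFun := Continuous.subtype_mk (continuous_finsetSum _ fun i _ ↦
    ((continuous_apply i).comp continuous_subtype_val).smul continuous_const) _

theorem exists_stdSimplex_homeomorph_closedBall [Fintype ι] [FiniteDimensional ℝ E]
    (h : Fintype.card ι = Module.finrank ℝ E + 1) :
    ∃ Φ : stdSimplex ℝ ι ≃ₜ Metric.closedBall (0 : E) 1,
      ∀ q, ‖(Φ q : E)‖ = 1 ↔ ∃ i, q i = 0 := by
  obtain ⟨b⟩ : Nonempty (AffineBasis ι ℝ E) :=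
    AffineBasis.exists_affineBasis_of_finiteDimensional h
  obtain ⟨Φ, hΦ⟩ := exists_homeomorph_closedBall ((Set.finite_range b).isCompact_convexHull ℝ)
    (convex_convexHull ℝ _) ⟨_, b.centroid_mem_interior_convexHull⟩
  refine ⟨(convexHullHomeomorph b).symm.trans Φ, fun q ↦ ?_⟩
  obtain ⟨x, rfl⟩ := (convexHullHomeomorph b).surjective q
  have hx (i) : 0 ≤ b.coord i x := b.convexHull_eq_nonneg_coord.subset x.2 i
  calc ‖(Φ ((convexHullHomeomorph b).symm (convexHullHomeomorph b x)) : E)‖ = 1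
    _ ↔ (x : E) ∉ interior (convexHull ℝ (Set.range b)) := by
        rw [Homeomorph.symm_apply_apply, hΦ]
    _ ↔ ∃ i, b.coord i x = 0 := by
        simp [b.interior_convexHull, (hx _).lt_iff_ne']

end SimplexBall

section CellComplexes

open Simplicial Opposite Limits HomotopicalAlgebra

section MapFunctor

universe w t v v' u₁ u'

variable {C : Type u₁} [Category.{v} C] {D : Type u'} [Category.{v'} D]

/-- The image of an attachment of cells under a functor that preserves the colimits involved. -/
noncomputable def mapAttachCells {α : Type t} {A B : α → C} {g : ∀ a, A a ⟶ B a} {X₁ X₂ : C}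
    {f : X₁ ⟶ X₂} (c : AttachCells.{w} g f) (F : C ⥤ D)
    [PreservesColimitsOfSize.{w, w} F] [PreservesColimitsOfShape WalkingSpan F] :
    AttachCells.{w} (fun a ↦ F.map (g a)) (F.map f) where
  ι := c.ι
  π := c.π
  cofan₁ := Cofan.mk (F.obj c.cofan₁.pt) fun i ↦ F.map (c.cofan₁.inj i)
  cofan₂ := Cofan.mk (F.obj c.cofan₂.pt) fun i ↦ F.map (c.cofan₂.inj i)
  isColimit₁ := isColimitCofanMkObjOfIsColimit F _ _
    (c.isColimit₁.ofIsoColimit (Cofan.ext (Iso.refl _) fun _ ↦ Category.comp_id _))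
  isColimit₂ := isColimitCofanMkObjOfIsColimit F _ _
    (c.isColimit₂.ofIsoColimit (Cofan.ext (Iso.refl _) fun _ ↦ Category.comp_id _))
  m := F.map c.m
  hm i := (F.map_comp _ _).symm.trans ((congrArg F.map (c.hm i)).trans (F.map_comp _ _))
  g₁ := F.map c.g₁
  g₂ := F.map c.g₂
  isPushout := c.isPushout.map F

/-- The image of a relative cell complex under a functor that preserves colimits and sends the
basic cells to given morphisms, up to isomorphism. -/
noncomputable def mapRelativeCellComplex {J : Type*} [LinearOrder J] [OrderBot J] [SuccOrder J]
    [WellFoundedLT J] {α : J → Type t} {A B : ∀ j, α j → C} {A' B' : ∀ j, α j → D}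
    {g : ∀ j a, A j a ⟶ B j a} {g' : ∀ j a, A' j a ⟶ B' j a} {X Y : C} {f : X ⟶ Y}
    (c : RelativeCellComplex.{w} g f) (F : C ⥤ D)
    [PreservesColimitsOfSize.{w, w} F] [PreservesColimitsOfShape WalkingSpan F]
    [PreservesWellOrderContinuousOfShape J F] [PreservesColimitsOfShape J F]
    (e : ∀ j a, Arrow.mk (F.map (g j a)) ≅ Arrow.mk (g' j a))
    {X' Y' : D} {f' : X' ⟶ Y'} (ef : Arrow.mk (F.map f) ≅ Arrow.mk f') :
    RelativeCellComplex.{w} g' f' where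
  toTransfiniteCompositionOfShape := (c.toTransfiniteCompositionOfShape.map F).ofArrowIso ef
  attachCells j hj := (mapAttachCells (c.attachCells j hj) F).reindexCellTypes _ id fun a ↦ e j a

end MapFunctor

theorem nonempty_arrow_iso_of_isEmbedding {A B A' B' : TopCat.{u}} {f : A ⟶ B} {g : A' ⟶ B'}
    (hf : Topology.IsEmbedding f) (hg : Topology.IsEmbedding g) (e : B ≃ₜ B')
    (h : ∀ b, b ∈ Set.range f ↔ e b ∈ Set.range g) : Nonempty (Arrow.mk f ≅ Arrow.mk g) := by
  have range_eq : Set.range (e ∘ f) = Set.range g := by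
    ext b'
    obtain ⟨b, rfl⟩ := e.surjective b'
    rw [Set.range_comp, e.injective.mem_set_image, h]
  let d : A ≃ₜ A' := (e.isEmbedding.comp hf).toHomeomorph.trans
    ((Homeomorph.setCongr range_eq).trans hg.toHomeomorph.symm)
  refine ⟨Arrow.isoMk (TopCat.isoOfHomeo d) (TopCat.isoOfHomeo e) ?_⟩
  ext a
  exact congrArg Subtype.val (hg.toHomeomorph.apply_symm_apply
    (Homeomorph.setCongr range_eq ((e.isEmbedding.comp hf).toHomeomorph a)))

theorem isEmbedding_diskBoundaryInclusion (n : ℕ) :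
    Topology.IsEmbedding (TopCat.diskBoundaryInclusion.{u} n) :=
  Homeomorph.ulift.symm.isEmbedding.comp
    ((Topology.IsEmbedding.inclusion Metric.sphere_subset_closedBall).comp
      Homeomorph.ulift.isEmbedding)

theorem mem_range_diskBoundaryInclusion_iff {n : ℕ} (y : TopCat.disk.{u} n) :
    y ∈ Set.range (TopCat.diskBoundaryInclusion.{u} n) ↔
      ‖(y.down : EuclideanSpace ℝ (Fin n))‖ = 1 := by
  constructor
  · rintro ⟨z, rfl⟩
    exact mem_sphere_zero_iff_norm.mp z.down.2
  · exact fun hy ↦ ⟨⟨y.down, mem_sphere_zero_iff_norm.mpr hy⟩, rfl⟩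

theorem nonempty_toTop_boundary_arrow_iso (n : ℕ) :
    Nonempty (Arrow.mk (SSet.toTop.map (∂Δ[n] : (Δ[n] : SSet.{u}).Subcomplex).ι) ≅
      Arrow.mk (TopCat.diskBoundaryInclusion.{u} n)) := by
  obtain ⟨Φ, hΦ⟩ := exists_stdSimplex_homeomorph_closedBall (ι := Fin (n + 1))
    (E := EuclideanSpace ℝ (Fin n)) (by simp)
  let e : |(Δ[n] : SSet.{u})| ≃ₜ TopCat.disk.{u} n :=
    (SimplexCategory.toTopHomeo ⦋n⦌).trans (Φ.trans Homeomorph.ulift.symm)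
  refine nonempty_arrow_iso_of_isEmbedding ?_ (isEmbedding_diskBoundaryInclusion n) e fun p ↦ ?_
  · exact ((SimplexCategory.toTopHomeo ⦋n⦌).isEmbedding.of_comp_iff).mp
      (Realization.isClosedEmbedding_coordinates _).isEmbedding
  · calc p ∈ Set.range (SSet.toTop.map (∂Δ[n] : (Δ[n] : SSet.{u}).Subcomplex).ι)
      _ ↔ SimplexCategory.toTopHomeo ⦋n⦌ p ∈ Set.range (Realization.coordinates
          (n := ⦋n⦌) (∂Δ[n] : (Δ[n] : SSet.{u}).Subcomplex)) :=
        exists_congr fun _ ↦ (SimplexCategory.toTopHomeo ⦋n⦌).injective.eq_iff.symm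
      _ ↔ ∃ i, SimplexCategory.toTopHomeo ⦋n⦌ p i = 0 :=
        Realization.mem_range_coordinates_boundary_iff _
      _ ↔ ‖((e p).down : EuclideanSpace ℝ (Fin n))‖ = 1 := (hΦ _).symm
      _ ↔ e p ∈ Set.range (TopCat.diskBoundaryInclusion.{u} n) :=
        (mem_range_diskBoundaryInclusion_iff _).symm

theorem nonempty_cwComplex_realization (X : SSet.{u}) : Nonempty (TopCat.CWComplex |X|) := by
  have hbot : IsInitial (SSet.toTop.obj ((⊥ : X.Subcomplex) : SSet.{u})) :=
    SSet.Subcomplex.isInitialBot.isInitialObj SSet.toTop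
  have : PreservesWellOrderContinuousOfShape ℕ SSet.toTop.{u} := ⟨fun _ _ ↦ inferInstance⟩
  exact ⟨mapRelativeCellComplex (SSet.relativeCellComplex X) SSet.toTop
    (fun n _ ↦ (nonempty_toTop_boundary_arrow_iso n).some)
    (Arrow.isoMk (hbot.uniqueUpToIso initialIsInitial) (Iso.refl _) (hbot.hom_ext _ _))⟩

end CellComplexes

section HigherHomotopyGroups

open scoped Topology.Homotopy unitInterval

variable {N : Type*}

/-- A function on the cube that vanishes on the boundary and is `1` on the central subcube of
side `1 / 2`. -/
noncomputable def cubeBump [Fintype N] (y : N → I) : I :=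
  ∏ i, Set.projIcc (0 : ℝ) 1 zero_le_one (min (4 * (y i : ℝ)) (4 * (1 - y i)))

/-- The expansion of the cube by the factor `1 + s` about its center, followed by the retraction
onto the cube. -/
noncomputable def cubeExpand (s : I) (y : N → I) : N → I := fun i ↦
  Set.projIcc (0 : ℝ) 1 zero_le_one (y i + s * (y i - 1 / 2))

@[fun_prop]
theorem continuous_cubeBump [Fintype N] : Continuous (cubeBump (N := N)) :=
  continuous_finsetProd _ fun i _ ↦ continuous_projIcc.comp (by fun_prop)

theorem continuous_cubeExpand : Continuous fun x : I × (N → I) ↦ cubeExpand x.1 x.2 :=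
  continuous_pi fun i ↦ continuous_projIcc.comp (by fun_prop)

theorem cubeBump_eq_zero [Fintype N] {y : N → I} (hy : y ∈ Cube.boundary N) : cubeBump y = 0 := by
  obtain ⟨i, hi⟩ := hy
  refine Finset.prod_eq_zero (Finset.mem_univ i) (Set.projIcc_of_le_left _ ?_)
  obtain hi | hi := hi <;> simp [hi]

theorem cubeExpand_zero (y : N → I) : cubeExpand 0 y = y := by
  funext i
  simp [cubeExpand]

theorem cubeExpand_mem_boundary (s : I) {y : N → I} (hy : y ∈ Cube.boundary N) :
    cubeExpand s y ∈ Cube.boundary N := by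
  obtain ⟨i, hi⟩ := hy
  have hs : (0 : ℝ) ≤ s := s.2.1
  refine ⟨i, hi.imp (fun h ↦ Set.projIcc_of_le_left _ ?_) fun h ↦ Set.projIcc_of_right_le _ ?_⟩
  · simp [h, hs]
  · simp only [h, Set.Icc.coe_one]
    linarith

theorem cubeExpand_one_mem_boundary [Fintype N] {y : N → I} (hy : cubeBump y ≠ 1) :
    cubeExpand 1 y ∈ Cube.boundary N := by
  obtain ⟨i, hi⟩ : ∃ i, min (4 * (y i : ℝ)) (4 * (1 - y i)) < 1 := by
    by_contra! h
    exact hy (Finset.prod_eq_one fun i _ ↦ Set.projIcc_of_right_le _ (h i))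
  refine ⟨i, (min_lt_iff.mp hi).imp (fun h ↦ Set.projIcc_of_le_left _ ?_)
    fun h ↦ Set.projIcc_of_right_le _ ?_⟩ <;>
  · simp only [Set.Icc.coe_one]
    linarith

variable {X : Type*} [TopologicalSpace X]

-- A contraction `H` moves the base point. With the time parameter `s * cubeBump y` it keeps the
-- boundary of the cube in place, and when `s = 1` it has reached the end wherever `cubeExpand 1`
-- has not yet carried `y` to the boundary, so that only the track of the base point remains.
theorem homotopic_const_of_contractibleSpace [Finite N] [ContractibleSpace X] {x : X}
    (f : Ω^ N X x) : GenLoop.Homotopic f GenLoop.const := by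
  have := Fintype.ofFinite N
  obtain ⟨v, ⟨H⟩⟩ := id_nullhomotopic X
  let track : C(N → I, X) := ⟨fun y ↦ H (cubeBump y, x), by fun_prop⟩
  have f_homotopic_track : f.1.HomotopicRel track (Cube.boundary N) := ⟨
    { toFun := fun z ↦ H (z.1 * cubeBump z.2, f (cubeExpand z.1 z.2))
      continuous_toFun := H.continuous.comp ((continuous_fst.mul
        (continuous_cubeBump.comp continuous_snd)).prodMk (f.1.continuous.comp
          continuous_cubeExpand))
      map_zero_left := fun y ↦ by simp [cubeExpand_zero]
      map_one_left := fun y ↦ by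
        by_cases hy : cubeBump y = 1
        · simp [track, hy]
        · simp [track, GenLoop.boundary f _ (cubeExpand_one_mem_boundary hy)]
      prop' := fun s y hy ↦ by
        simp [cubeBump_eq_zero hy, GenLoop.boundary f _ hy,
          GenLoop.boundary f _ (cubeExpand_mem_boundary s hy)] }⟩
  have track_homotopic_const :
      track.HomotopicRel (GenLoop.const : Ω^ N X x).1 (Cube.boundary N) := ⟨
    { toFun := fun z ↦ H (σ z.1 * cubeBump z.2, x)
      continuous_toFun := by fun_prop
      map_zero_left := fun y ↦ by simp [track]
      map_one_left := fun y ↦ by simp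
      prop' := fun s y hy ↦ by simp [track, cubeBump_eq_zero hy] }⟩
  exact f_homotopic_track.trans track_homotopic_const

instance subsingleton_homotopyGroup_of_contractibleSpace [Finite N] [ContractibleSpace X]
    (x : X) : Subsingleton (HomotopyGroup N X x) := by
  refine subsingleton_of_forall_eq (Quotient.mk _ GenLoop.const) fun q ↦ ?_
  obtain ⟨f, rfl⟩ := Quotient.exists_rep q
  exact Quotient.sound (homotopic_const_of_contractibleSpace f)

theorem isPreconnected_setOf_apply_eq (i : N) (a : I) :
    _root_.IsPreconnected {y : N → I | y i = a} := by
  classical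
  have : {y : N → I | y i = a} =
      Set.univ.pi (Function.update (fun _ ↦ (Set.univ : Set I)) i {a}) := by
    ext y
    simp [Function.forall_update_iff (fun _ ↦ Set.univ) fun j s ↦ y j ∈ s]
  rw [this]
  refine isPreconnected_univ_pi fun j ↦ ?_
  obtain rfl | hj := eq_or_ne j i
  · simpa using isPreconnected_singleton
  · simpa [hj] using isPreconnected_univ

theorem isPreconnected_cubeBoundary [Nontrivial N] :
    _root_.IsPreconnected (Cube.boundary N) := by
  classical
  refine isPreconnected_of_forall 0 fun y ⟨i, hi⟩ ↦ ?_
  obtain ⟨j, hj⟩ := exists_ne i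
  refine ⟨{z | z i = y i} ∪ {z | z j = 0}, Set.union_subset (fun z hz ↦ ⟨i, ?_⟩)
    (fun z hz ↦ ⟨j, Or.inl hz⟩), Or.inr rfl, Or.inl rfl, ?_⟩
  · rwa [show z i = y i from hz]
  · exact _root_.IsPreconnected.union (Function.update (0 : N → I) i (y i)) (by simp) (by simp [hj])
      (isPreconnected_setOf_apply_eq i (y i)) (isPreconnected_setOf_apply_eq j 0)

variable {E : Type*} [TopologicalSpace E] {p : E → X}

theorem exists_lift_of_leftInverse {A B : Type*} [TopologicalSpace A] [TopologicalSpace B]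
    [SimplyConnectedSpace B] [LocallyPathConnectedSpace B] (hp : IsCoveringMap p) {r : C(B, A)}
    {s : C(A, B)} (hrs : Function.LeftInverse r s) (f : C(A, X)) (a : A) {e : E}
    (he : p e = f a) : ∃ F : C(A, E), F a = e ∧ ∀ x, p (F x) = f x := by
  obtain ⟨F, ⟨hF_apply, hF⟩, -⟩ := hp.existsUnique_continuousMap_lifts (f.comp r) (s a) e
    (by rw [he, ContinuousMap.comp_apply, hrs])
  refine ⟨F.comp s, hF_apply, fun x ↦ (congrFun hF (s x)).trans ?_⟩
  rw [ContinuousMap.comp_apply, hrs]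

theorem exists_genLoop_lift [Finite N] [Nontrivial N] (hp : IsCoveringMap p) {e : E}
    (f : Ω^ N X (p e)) : ∃ F : Ω^ N E e, ∀ y, p (F y) = f y := by
  have zero_mem : (0 : N → I) ∈ Cube.boundary N := ⟨Classical.arbitrary N, Or.inl rfl⟩
  let r : C(N → ℝ, N → I) := ⟨fun y i ↦ Set.projIcc (0 : ℝ) 1 zero_le_one (y i),
    continuous_pi fun i ↦ continuous_projIcc.comp (continuous_apply i)⟩
  let s : C(N → I, N → ℝ) := ⟨fun y i ↦ y i, by fun_prop⟩
  obtain ⟨F, hF_zero, hF⟩ := exists_lift_of_leftInverse hp (r := r) (s := s)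
    (fun y ↦ funext fun i ↦ Set.projIcc_val zero_le_one (y i)) f.1 0
    (GenLoop.boundary f 0 zero_mem).symm
  refine ⟨⟨F, fun y hy ↦ ?_⟩, hF⟩
  rw [← hF_zero]
  refine hp.constOn_of_comp isPreconnected_cubeBoundary F.continuous.continuousOn
    (fun z hz z' hz' ↦ ?_) hy zero_mem
  have p_eq {w} (hw : w ∈ Cube.boundary N) : p (F w) = p e :=
    (hF w).trans (GenLoop.boundary f w hw)
  exact (p_eq hz).trans (p_eq hz').symm

theorem subsingleton_homotopyGroup_of_isCoveringMap [Finite N] [Nontrivial N]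
    (hp : IsCoveringMap p) (e : E) [Subsingleton (HomotopyGroup N E e)] :
    Subsingleton (HomotopyGroup N X (p e)) := by
  refine subsingleton_of_forall_eq (Quotient.mk _ GenLoop.const) fun q ↦ ?_
  obtain ⟨f, rfl⟩ := Quotient.exists_rep q
  obtain ⟨F, hF⟩ := exists_genLoop_lift hp f
  have hF_const : GenLoop.Homotopic F GenLoop.const :=
    Quotient.exact (Subsingleton.elim (α := HomotopyGroup N E e) _ _)
  have comp_F : (⟨p, hp.continuous⟩ : C(E, X)).comp F.1 = f.1 := ContinuousMap.ext hF
  have h := hF_const.comp_continuousMap (g := ⟨p, hp.continuous⟩)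
  rw [comp_F] at h
  exact Quotient.sound h

end HigherHomotopyGroups

section RightGroupoid

open Simplicial Opposite Limits

namespace RightGroupoid

variable {G : Type u} [Group G]

instance : HasInitial (RightGroupoid G) :=
  have hom (a : RightGroupoid G) : mk 1 ⟶ a := ⟨a.elt, one_mul a.elt⟩
  (IsInitial.ofUniqueHom hom fun _ _ ↦ hom_eq _ _).hasInitial

theorem functor_ext {C : Type*} [Category* C] {F F' : C ⥤ RightGroupoid G}
    (h : ∀ c, (F.obj c).elt = (F'.obj c).elt) : F = F' :=
  CategoryTheory.Functor.ext (fun c ↦ congrArg mk (h c)) fun _ _ _ ↦ hom_eq _ _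

theorem exists_comp_proj_eq {n : ℕ} (τ : ComposableArrows (SingleObj G) n) :
    ∃ σ : ComposableArrows (RightGroupoid G) n, σ ⋙ proj G = τ := by
  let toGroup {i j : Fin (n + 1)} (x : i ⟶ j) : G := τ.map x
  have toGroup_comp {i j k : Fin (n + 1)} (x : i ⟶ j) (y : j ⟶ k) :
      toGroup (x ≫ y) = toGroup y * toGroup x := τ.map_comp x y
  let σ : ComposableArrows (RightGroupoid G) n :=
    { obj i := ⟨(toGroup (homOfLE (Fin.zero_le i)))⁻¹⟩
      map x := ⟨(toGroup x)⁻¹, by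
        rw [← mul_inv_rev, ← toGroup_comp]
        rfl⟩
      map_id _ := hom_eq _ _
      map_comp _ _ := hom_eq _ _ }
  have σ_comp_proj_map {i j : Fin (n + 1)} (x : i ⟶ j) : (σ ⋙ proj G).map x = τ.map x :=
    inv_inv (toGroup x)
  exact ⟨σ, CategoryTheory.Functor.ext (fun _ ↦ rfl) fun i j x ↦ by
    rw [σ_comp_proj_map, eqToHom_refl]
    exact ((Category.id_comp _).trans (Category.comp_id _)).symm⟩

theorem exists_comp_translate_eq {n : ℕ} {σ σ' : ComposableArrows (RightGroupoid G) n}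
    (hσ : σ ⋙ proj G = σ' ⋙ proj G) : ∃ h : G, σ ⋙ translate h = σ' := by
  refine ⟨(σ'.obj 0).elt * (σ.obj 0).elt⁻¹, functor_ext fun i ↦ ?_⟩
  let x := σ.map (homOfLE (Fin.zero_le i))
  let x' := σ'.map (homOfLE (Fin.zero_le i))
  have hx : x.1 = x'.1 := inv_injective <|
    congrArg (fun F : Fin (n + 1) ⥤ SingleObj G ↦ (F.map (homOfLE (Fin.zero_le i)) : G)) hσ
  calc (σ'.obj 0).elt * (σ.obj 0).elt⁻¹ * (σ.obj i).elt
    _ = (σ'.obj 0).elt * (σ.obj 0).elt⁻¹ * ((σ.obj 0).elt * x'.1) := by rw [← hx, x.2]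
    _ = (σ'.obj 0).elt * x'.1 := by rw [mul_assoc, inv_mul_cancel_left]
    _ = (σ'.obj i).elt := x'.2

theorem isOrbitMap_nerveProj :
    IsOrbitMap (fun h : G ↦ nerveMap (translate h)) (nerveProj G) where
  surjective _ := exists_comp_proj_eq
  app_eq_app_iff := by
    refine ⟨exists_comp_translate_eq, ?_⟩
    rintro ⟨h, rfl⟩
    rfl

theorem eq_one_of_nerveMap_translate_eq (h : G) (v : (nerve (RightGroupoid G)).obj (op ⦋0⦌))
    (hv : (nerveMap (translate h)).app (op ⦋0⦌) v = v) : h = 1 :=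
  mul_eq_right.mp <|
    congrArg (fun σ : ComposableArrows (RightGroupoid G) 0 ↦ (σ.obj 0).elt) hv

end RightGroupoid

end RightGroupoid

section EilenbergMacLane

open Simplicial

variable (G : Type u) [Group G]

namespace BrG

noncomputable instance : MulAction G |nerve (RightGroupoid G)| :=
  inferInstanceAs (MulAction G (BrG G))

instance : ContractibleSpace (BrG G) :=
  contractibleSpace_classifyingSpace (RightGroupoid G)

theorem exists_orbitHomeomorph :
    ∃ e : MulAction.orbitRel.Quotient G (BrG G) ≃ₜ BG G,
      ∀ p : BrG G, e (Quotient.mk _ p) = toBG G p :=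
  Realization.exists_orbitHomeomorph (fun _ _ ↦ rfl) RightGroupoid.isOrbitMap_nerveProj

theorem isQuotientCoveringMap_toBG : IsQuotientCoveringMap (toBG G) G :=
  Realization.isQuotientCoveringMap_toTop_map (fun _ _ ↦ rfl)
    RightGroupoid.isOrbitMap_nerveProj RightGroupoid.eq_one_of_nerveMap_translate_eq

end BrG

theorem isEilenbergMacLaneOne_BG : IsEilenbergMacLaneOne G (BG G) := by
  have hp := BrG.isQuotientCoveringMap_toBG G
  refine ⟨nonempty_cwComplex_realization _,
    hp.surjective.pathConnectedSpace (BrG.toBG G).continuous, fun x ↦ ?_, fun n hn x ↦ ?_⟩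
  · obtain ⟨p, h⟩ := hp.surjective x
    exact ⟨HomotopyGroup.pi1MulEquivFundamentalGroup.trans
      ((hp.fundamentalGroupEquiv ⟨p, h⟩).trans (MulEquiv.inv' G).symm)⟩
  · have : Nontrivial (Fin n) := Fin.nontrivial_iff_two_le.mpr hn
    obtain ⟨p, rfl⟩ := hp.surjective x
    exact subsingleton_homotopyGroup_of_isCoveringMap hp.isCoveringMap p

end EilenbergMacLane

theorem theorem6 (G : Type u) [Group G] :
    IsEilenbergMacLaneOne G (BG G) ∧
    ∃ e : MulAction.orbitRel.Quotient G (BrG G) ≃ₜ BG G,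
      ∀ p : BrG G, e (Quotient.mk _ p) = BrG.toBG G p :=
  ⟨isEilenbergMacLaneOne_BG G, BrG.exists_orbitHomeomorph G⟩
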